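/- For a measurable function $f:\mathbb{R}^n\to\mathbb{C}$ and $t>0$ let $f^{*}(t)=\inf\{s>0:\ |\{x\in\mathbb{R}^n:|f(x)|>s\}|\le t\}$ and $f^{**}(t)=\frac1t\int_0^t f^{*}(s)\,ds$. For $1<p<\infty$ and $1\le q\le\infty$ put $$\|f\|_{(p,q)}=\Big(\frac pq\int_0^\infty\big[t^{1/p}f^{**}(t)\big]^q\,\frac{dt}{t}\Big)^{1/q}\ (q<\infty),\qquad \|f\|_{(p,\infty)}=\sup_{t>0}t^{1/p}f^{**}(t),$$ and let $L^{(p,q)}(\mathbb{R}^n)$ be the Lorentz space of all measurable $f$ with $\|f\|_{(p,q)}<\infty$. Let $S(t)$, $t\in\mathbb{R}$, be the Schrödinger group of $\partial_t u-i\Delta u=0$ on $\mathbb{R}^n$, acting on tempered distributions by $\widehat{S(t)\varphi}(\xi)=e^{-it|\xi|^2}\widehat{\varphi}(\xi)$, where $\widehat{\varphi}(\xi)=\int_{\mathbb{R}^n} e^{-ix\cdot\xi}\varphi(x)\,dx$ for Schwartz functions $\varphi$. **Lemma.** Let $1<p<2$ and $\frac1p+\frac1{p'}=1$. There is a constant $C=C(n,p)>0$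 such that for all $1\le d\le\infty$, all $\varphi\in L^{(p,d)}(\mathbb{R}^n)$ and all $t\ne0$, the function $\varphi$ defines a tempered distribution, the tempered distribution $S(t)\varphi$ is a function in $L^{(p',d)}(\mathbb{R}^n)$, and $$\|S(t)\varphi\|_{(p',d)}\le C\,|t|^{-\frac n2\left(\frac2p-1\right)}\|\varphi\|_{(p,d)}.$$ -/

import Mathlib

open MeasureTheory
open scoped ENNReal SchwartzMap

namespace LorentzSchrodinger

noncomputable section

/-- The space `ℝⁿ` with its Euclidean norm (and Lebesgue measure `volume`). -/
abbrev Space (n : ℕ) : Type := EuclideanSpace ℝ (Fin n)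

/-! ### Lorentz spaces -/

/-- The decreasing rearrangement `f*(t) = inf {s > 0 : m {x : |f x| > s} ≤ t}`, with values in
`[0, ∞]` (it is `∞` exactly if no finite `s` is admissible, `inf ∅ = ∞`). -/
def rearrangement {n : ℕ} (f : Space n → ℂ) (t : ℝ) : ℝ≥0∞ :=
  sInf {s : ℝ≥0∞ | 0 < s ∧ volume {x : Space n | s < ‖f x‖ₑ} ≤ ENNReal.ofReal t}

/-- The averaged rearrangement `f**(t) = (1 / t) ∫₀ᵗ f*(s) ds`, for `t > 0`. -/
def maximalRearrangement {n : ℕ} (f : Space n → ℂ) (t : ℝ) : ℝ≥0∞ :=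
  (ENNReal.ofReal t)⁻¹ * ∫⁻ s in Set.Ioo (0 : ℝ) t, rearrangement f s

/-- The Lorentz norm `‖f‖_{(p,q)}` for `1 < p < ∞` and `1 ≤ q ≤ ∞`, with values in `[0, ∞]`:
`(p / q ∫₀^∞ (t^{1/p} f**(t))^q dt / t)^{1/q}` if `q < ∞`, and `sup_{t > 0} t^{1/p} f**(t)` if
`q = ∞`. -/
def lorentzNorm {n : ℕ} (p : ℝ) (q : ℝ≥0∞) (f : Space n → ℂ) : ℝ≥0∞ :=
  if q = ∞ then
    ⨆ (t : ℝ) (_ : 0 < t), ENNReal.ofReal (t ^ (1 / p)) * maximalRearrangement f t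
  else
    (ENNReal.ofReal (p / q.toReal) *
      ∫⁻ t in Set.Ioi (0 : ℝ),
        (ENNReal.ofReal (t ^ (1 / p)) * maximalRearrangement f t) ^ q.toReal *
          (ENNReal.ofReal t)⁻¹) ^ (1 / q.toReal)

/-- `f` belongs to the Lorentz space `L^{(p,q)}(ℝⁿ)`. -/
def MemLorentz {n : ℕ} (p : ℝ) (q : ℝ≥0∞) (f : Space n → ℂ) : Prop :=
  AEStronglyMeasurable f volume ∧ lorentzNorm p q f < ∞

/-! ### The Schrödinger group -/

/-- The Fourier multiplier of `S(t)`. Mathlib's Fourier transform has the kernel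
`exp (-2πi⟨x, ξ⟩)`, for which `Δ` has the symbol `-|2πξ|²`; hence the solution operator of
`∂ₜu - iΔu = 0` has the symbol `exp (-it|2πξ|²)`. -/
def schrodingerSymbol {n : ℕ} (t : ℝ) (ξ : Space n) : ℂ :=
  Complex.exp (-(Complex.I * ((t * (2 * Real.pi * ‖ξ‖) ^ 2 : ℝ) : ℂ)))

/-- The symbol is an admissible Fourier multiplier of tempered distributions. -/
theorem hasTemperateGrowth_schrodingerSymbol {n : ℕ} (t : ℝ) :
    (schrodingerSymbol (n := n) t).HasTemperateGrowth := by
  have hexp : (fun s : ℝ => Complex.exp ((s : ℂ) * (-Complex.I))).HasTemperateGrowth := by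
    have hd : ∀ s : ℝ, HasDerivAt (fun s : ℝ => Complex.exp ((s : ℂ) * (-Complex.I)))
        (Complex.exp ((s : ℂ) * (-Complex.I)) * (-Complex.I)) s := by
      intro s
      have h1 : HasDerivAt (fun s : ℝ => (s : ℂ) * (-Complex.I)) (1 * (-Complex.I)) s :=
        (Complex.ofRealCLM.hasDerivAt (x := s)).mul_const _
      simpa using h1.cexp
    have hit : ∀ m : ℕ, iteratedDeriv m (fun s : ℝ => Complex.exp ((s : ℂ) * (-Complex.I))) =
        fun s : ℝ => Complex.exp ((s : ℂ) * (-Complex.I)) * (-Complex.I) ^ m := by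
      intro m
      induction m with
      | zero => simp
      | succ m ih =>
        rw [iteratedDeriv_succ, ih]
        funext s
        rw [((hd s).mul_const _).deriv]
        ring
    refine ⟨?_, fun m => ⟨0, 1, fun s => ?_⟩⟩
    · exact ((Complex.ofRealCLM.contDiff).mul contDiff_const).cexp
    · rw [norm_iteratedFDeriv_eq_norm_iteratedDeriv, hit]
      simp [Complex.norm_exp]
  have hsq : (fun ξ : Space n => t * (2 * Real.pi) ^ 2 * ‖ξ‖ ^ 2).HasTemperateGrowth := by
    fun_prop
  have := hexp.comp hsq
  convert this using 1
  funext ξ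
  simp only [schrodingerSymbol, Function.comp]
  congr 1
  push_cast
  ring

/-- The Schrödinger group `S(t) = e^{itΔ}` on tempered distributions. -/
def schrodingerGroup {n : ℕ} (t : ℝ) : 𝓢'(Space n, ℂ) →L[ℂ] 𝓢'(Space n, ℂ) :=
  TemperedDistribution.fourierMultiplierCLM ℂ (schrodingerSymbol t)

/-- The tempered distribution `T` is given by integration against the locally integrable
function `f`. -/
def IsGivenBy {n : ℕ} (T : 𝓢'(Space n, ℂ)) (f : Space n → ℂ) : Prop :=
  LocallyIntegrable f volume ∧
    ∀ g : 𝓢(Space n, ℂ), Integrable (fun x => g x * f x) volume ∧ T g = ∫ x, g x * f x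

/-- The function `ψ` is (a representative of) `S(t)φ`: the function `φ` defines a tempered
distribution, and its image under `S(t)` is the tempered distribution given by `ψ`. -/
def IsSchrodingerFlow {n : ℕ} (t : ℝ) (φ ψ : Space n → ℂ) : Prop :=
  ∃ T : 𝓢'(Space n, ℂ), IsGivenBy T φ ∧ IsGivenBy (schrodingerGroup t T) ψ

end

end LorentzSchrodinger

/-! The estimate is real interpolation between two endpoint bounds: $L^1\to L^\infty$ with norm at
most $K=(4\pi|t|)^{-n/2}$, from the explicit kernel, and $L^2\to L^2$ with norm at most one, from a
Fourier multiplier of modulus one. The interpolation is done by hand on rearrangements, which keeps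
the constant independent of $d$.

For every $s>0$, cut $\varphi$ at height $\varphi^*(s)$. The large part has $L^1$ norm at most
$s\varphi^{**}(s)$, and the small part has $L^2$ norm at most $2\sum_k(2^ks)^{1/2}\varphi^*(2^ks)$
(`exists_decomposition`). Both are controlled by the sum of $r^k h(2^ks)$ with
$h(s)=s^{1/p}\varphi^{**}(s)$ and $r=2^{1/2-1/p}<1$. Evolving the two parts and choosing
$s=K^{-2}/u$ gives $u^{1/p'}\psi^{**}(u)\le 5K^{2/p-1}\sum_k r^k h(2^kK^{-2}/u)$ for
$\psi=S(t)\varphi$ (`rpow_mul_maximalRearrangement_le_dyadicSum`).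

The measure $du/u$ is invariant under $u\mapsto c/u$, so Jensen's inequality for the weights $r^k$
turns this pointwise bound into the norm bound for every $d$
(`lorentzNorm_le_of_rpow_mul_maximalRearrangement_le`). The splitting depends on $u$, but a function
representing $S(t)\varphi$ is unique almost everywhere, so all splittings describe the same $\psi$.
-/

namespace LorentzSchrodinger

/-! ### Rearrangements, and the two parts of a function cut at height $f^*(s)$ -/

section Rearrangement

variable {n : ℕ} {f g : Space n → ℂ}

/-- The infimum defining $f^*$ is attained apart from the requirement of positivity: the superlevel
sets increase to the one at level $s$ as the levels decrease to $s$, and measure is continuous from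
below. -/
theorem rearrangement_le_iff {t : ℝ} {s : ℝ≥0∞} :
    rearrangement f t ≤ s ↔ volume {x : Space n | s < ‖f x‖ₑ} ≤ ENNReal.ofReal t := by
  constructor
  · intro h
    rcases eq_or_ne s ∞ with rfl | hs
    · simp
    obtain ⟨u, hu, hus, hlim⟩ := exists_seq_strictAnti_tendsto' (show s < ∞ from hs.lt_top)
    have hset : {x : Space n | s < ‖f x‖ₑ} = ⋃ k, {x : Space n | u k < ‖f x‖ₑ} := by
      ext x
      simp only [Set.mem_ofPred_eq, Set.mem_iUnion]
      constructor
      · intro hx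
        exact ((tendsto_order.1 hlim).2 _ hx).exists
      · rintro ⟨k, hk⟩
        exact (hus k).1.trans hk
    have hmono : Monotone fun k => {x : Space n | u k < ‖f x‖ₑ} := by
      intro i j hij x hx
      exact lt_of_le_of_lt (hu.antitone hij) hx
    rw [hset, hmono.measure_iUnion]
    refine iSup_le fun k => ?_
    obtain ⟨r, hr, hrk⟩ := sInf_lt_iff.1 (lt_of_le_of_lt h (hus k).1)
    exact le_trans (measure_mono fun x hx => lt_trans hrk hx) hr.2
  · intro h
    refine le_of_forall_gt_imp_ge_of_dense fun r hr => ?_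
    refine sInf_le ⟨lt_of_le_of_lt zero_le hr, ?_⟩
    exact le_trans (measure_mono fun x hx => lt_trans hr hx) h

theorem lt_rearrangement_iff {t : ℝ} {s : ℝ≥0∞} :
    s < rearrangement f t ↔ ENNReal.ofReal t < volume {x : Space n | s < ‖f x‖ₑ} := by
  rw [← not_le, ← not_le, rearrangement_le_iff]

theorem rearrangement_antitone : Antitone (rearrangement f) := fun _ _ h =>
  rearrangement_le_iff.2 ((rearrangement_le_iff.1 le_rfl).trans (ENNReal.ofReal_le_ofReal h))

theorem measurable_rearrangement : Measurable (rearrangement f) :=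
  rearrangement_antitone.measurable

theorem rearrangement_congr_ae (h : f =ᵐ[volume] g) : rearrangement f = rearrangement g := by
  funext t
  have : ∀ s : ℝ≥0∞, volume {x : Space n | s < ‖f x‖ₑ} = volume {x : Space n | s < ‖g x‖ₑ} := by
    intro s
    refine measure_congr ?_
    filter_upwards [h] with x hx
    refine propext ?_
    change s < ‖f x‖ₑ ↔ s < ‖g x‖ₑ
    rw [hx]
  simp only [rearrangement, this]

theorem maximalRearrangement_congr_ae (h : f =ᵐ[volume] g) :
    maximalRearrangement f = maximalRearrangement g := by
  funext t
  simp only [maximalRearrangement, rearrangement_congr_ae h]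

theorem lorentzNorm_congr_ae (h : f =ᵐ[volume] g) (p : ℝ) (q : ℝ≥0∞) :
    lorentzNorm p q f = lorentzNorm p q g := by
  simp only [lorentzNorm, maximalRearrangement_congr_ae h]

/-- One half of the equimeasurability of a function and its rearrangement. -/
theorem measure_lt_le_volume_lt_rearrangement (s : ℝ≥0∞) :
    volume {x : Space n | s < ‖f x‖ₑ} ≤
      volume.restrict (Set.Ioi (0 : ℝ)) {u | s < rearrangement f u} := by
  rw [Measure.restrict_apply (measurableSet_lt measurable_const measurable_rearrangement)]
  simp only [lt_rearrangement_iff]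
  -- For every finite $r$ below the measure on the left, the whole interval $(0,r)$ lies in the set
  -- on the right.
  refine ENNReal.le_of_forall_nnreal_lt fun r hr => ?_
  calc (r : ℝ≥0∞) = volume (Set.Ioo (0 : ℝ) r) := by simp
    _ ≤ _ := measure_mono ?_
  rintro u ⟨hu0, hur⟩
  refine ⟨lt_of_le_of_lt ?_ hr, hu0⟩
  rw [ENNReal.ofReal_le_iff_le_toReal ENNReal.coe_ne_top]
  exact hur.le

theorem mul_maximalRearrangement {t : ℝ} (ht : 0 < t) :
    ENNReal.ofReal t * maximalRearrangement f t =
      ∫⁻ s in Set.Ioo (0 : ℝ) t, rearrangement f s := by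
  rw [maximalRearrangement, ← mul_assoc, ENNReal.mul_inv_cancel (by simpa using ht)
    ENNReal.ofReal_ne_top, one_mul]

theorem maximalRearrangement_le_iff {t : ℝ} (ht : 0 < t) {c : ℝ≥0∞} :
    maximalRearrangement f t ≤ c ↔
      ∫⁻ s in Set.Ioo (0 : ℝ) t, rearrangement f s ≤ ENNReal.ofReal t * c := by
  rw [← mul_maximalRearrangement ht, ENNReal.mul_le_mul_iff_right (by simpa using ht)
    ENNReal.ofReal_ne_top]

theorem rearrangement_le_maximalRearrangement {t : ℝ} (ht : 0 < t) :
    rearrangement f t ≤ maximalRearrangement f t := by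
  rw [← ENNReal.mul_le_mul_iff_right (a := ENNReal.ofReal t) (by simpa using ht)
    ENNReal.ofReal_ne_top, mul_maximalRearrangement ht]
  calc ENNReal.ofReal t * rearrangement f t
      = ∫⁻ s in Set.Ioo (0 : ℝ) t, rearrangement f t := by
        rw [setLIntegral_const, Real.volume_Ioo, sub_zero, mul_comm]
    _ ≤ _ := setLIntegral_mono measurable_rearrangement fun s hs => rearrangement_antitone hs.2.le

theorem measurable_maximalRearrangement : Measurable (maximalRearrangement f) := by
  refine (ENNReal.measurable_ofReal.inv).mul (Monotone.measurable fun a b hab => ?_)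
  exact lintegral_mono_set (Set.Ioo_subset_Ioo_right hab)

/-- Comparison of distribution functions implies comparison of moments. -/
theorem lintegral_enorm_rpow_le_of_measure_lt_le {α β : Type*} [MeasurableSpace α]
    [MeasurableSpace β] {μ : Measure α} {ν : Measure β} {g : α → ℂ} {h : β → ℝ≥0∞}
    (hg : AEStronglyMeasurable g μ) (hh : Measurable h) {p : ℝ} (hp : 0 < p)
    (H : ∀ s : ℝ, 0 < s → μ {x | ENNReal.ofReal s < ‖g x‖ₑ} ≤ ν {y | ENNReal.ofReal s < h y}) :
    ∫⁻ x, ‖g x‖ₑ ^ p ∂μ ≤ ∫⁻ y, h y ^ p ∂ν := by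
  -- If the right side is finite, $h$ is finite almost everywhere and the layer-cake formula for
  -- real-valued functions applies to both sides.
  rcases eq_or_ne (∫⁻ y, h y ^ p ∂ν) ∞ with htop | htop
  · rw [htop]; exact le_top
  have hfin : ∀ᵐ y ∂ν, h y < ∞ := by
    filter_upwards [ae_lt_top (hh.pow_const p) htop] with y hy
    exact (ENNReal.rpow_lt_top_iff_of_pos hp).1 hy
  have h1 : ∫⁻ x, ‖g x‖ₑ ^ p ∂μ = ∫⁻ x, ENNReal.ofReal (‖g x‖ ^ p) ∂μ := by
    refine lintegral_congr fun x => ?_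
    rw [← ENNReal.ofReal_rpow_of_nonneg (norm_nonneg _) hp.le, ofReal_norm]
  have h2 : ∫⁻ y, h y ^ p ∂ν = ∫⁻ y, ENNReal.ofReal ((h y).toReal ^ p) ∂ν := by
    refine lintegral_congr_ae ?_
    filter_upwards [hfin] with y hy
    rw [← ENNReal.ofReal_rpow_of_nonneg ENNReal.toReal_nonneg hp.le, ENNReal.ofReal_toReal hy.ne]
  rw [h1, h2, lintegral_rpow_eq_lintegral_meas_lt_mul μ
      (Filter.Eventually.of_forall fun x => norm_nonneg _) hg.norm.aemeasurable hp,
    lintegral_rpow_eq_lintegral_meas_lt_mul ν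
      (Filter.Eventually.of_forall fun x => ENNReal.toReal_nonneg) hh.ennreal_toReal.aemeasurable hp]
  gcongr ENNReal.ofReal p * ?_
  refine setLIntegral_mono' measurableSet_Ioi fun s hs => ?_
  gcongr ?_ * _
  have hs' : (0 : ℝ) < s := hs
  calc μ {x | s < ‖g x‖} = μ {x | ENNReal.ofReal s < ‖g x‖ₑ} := by
        congr 1; ext x
        simp only [Set.mem_ofPred_eq]
        rw [← ofReal_norm, ENNReal.ofReal_lt_ofReal_iff_of_nonneg hs'.le]
    _ ≤ ν {y | ENNReal.ofReal s < h y} := H s hs'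
    _ = ν {y | s < (h y).toReal} := by
        refine measure_congr ?_
        filter_upwards [hfin] with y hy
        refine propext ?_
        change ENNReal.ofReal s < h y ↔ s < (h y).toReal
        rw [ENNReal.ofReal_lt_iff_lt_toReal hs'.le hy.ne]

/-- On $A$ the level $r$ can be replaced by $\max(r,f^*(s))$. By monotonicity, $f^*(u)>f^*(s)$
forces $u<s$, so only $(0,s)$ contributes. -/
theorem lintegral_enorm_indicator_le {A : Set (Space n)} {s : ℝ}
    (hA : A = {x | rearrangement f s < ‖f x‖ₑ}) (hf : AEStronglyMeasurable (A.indicator f) volume) :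
    ∫⁻ x, ‖A.indicator f x‖ₑ ≤ ∫⁻ u in Set.Ioo (0 : ℝ) s, rearrangement f u := by
  have := lintegral_enorm_rpow_le_of_measure_lt_le (μ := volume)
    (ν := volume.restrict (Set.Ioo (0 : ℝ) s)) hf
    (measurable_rearrangement (f := f)) one_pos ?_
  · simpa using this
  intro r hr
  calc volume {x | ENNReal.ofReal r < ‖A.indicator f x‖ₑ}
      ≤ volume {x | max (ENNReal.ofReal r) (rearrangement f s) < ‖f x‖ₑ} := by
        refine measure_mono fun x hx => ?_
        by_cases hxA : x ∈ A
        · simp only [Set.mem_ofPred_eq, Set.indicator_of_mem hxA] at hx ⊢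
          rw [hA] at hxA
          exact max_lt hx hxA
        · simp [Set.indicator_of_notMem hxA] at hx
    _ ≤ volume.restrict (Set.Ioi (0 : ℝ))
          {u | max (ENNReal.ofReal r) (rearrangement f s) < rearrangement f u} :=
        measure_lt_le_volume_lt_rearrangement _
    _ ≤ volume.restrict (Set.Ioo (0 : ℝ) s) {u | ENNReal.ofReal r < rearrangement f u} := by
        rw [Measure.restrict_apply (measurableSet_lt measurable_const measurable_rearrangement),
          Measure.restrict_apply (measurableSet_lt measurable_const measurable_rearrangement)]
        refine measure_mono ?_
        rintro u ⟨hu, hu0⟩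
        simp only [Set.mem_ofPred_eq, max_lt_iff] at hu
        obtain ⟨hu1, hu2⟩ := hu
        refine ⟨hu1, hu0, ?_⟩
        by_contra hcon
        exact absurd hu2 (not_lt.2 (rearrangement_antitone (not_lt.1 hcon)))

/-- Off $A$ the modulus of $f$ is at most $f^*(s)$: levels from $f^*(s)$ upwards give empty sets,
and lower levels are dominated by those of $f$. -/
theorem lintegral_enorm_sq_indicator_le {A : Set (Space n)} {s : ℝ}
    (hA : A = {x | rearrangement f s < ‖f x‖ₑ})
    (hf : AEStronglyMeasurable (Aᶜ.indicator f) volume) :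
    ∫⁻ x, ‖Aᶜ.indicator f x‖ₑ ^ (2 : ℝ) ≤
      ∫⁻ u in Set.Ioi (0 : ℝ), (min (rearrangement f u) (rearrangement f s)) ^ (2 : ℝ) := by
  refine lintegral_enorm_rpow_le_of_measure_lt_le hf
    (measurable_rearrangement.min measurable_const) two_pos fun r hr => ?_
  by_cases hrs : ENNReal.ofReal r < rearrangement f s
  · calc volume {x | ENNReal.ofReal r < ‖Aᶜ.indicator f x‖ₑ}
        ≤ volume {x | ENNReal.ofReal r < ‖f x‖ₑ} := by
          refine measure_mono fun x hx => lt_of_lt_of_le (Set.mem_ofPred_eq ▸ hx) ?_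
          exact enorm_indicator_le_enorm_self _ _
      _ ≤ _ := measure_lt_le_volume_lt_rearrangement _
      _ ≤ _ := measure_mono fun u hu => lt_min hu hrs
  · refine le_of_eq_of_le ?_ zero_le
    convert measure_empty (μ := (volume : Measure (Space n)))
    ext x
    simp only [Set.mem_ofPred_eq, Set.mem_empty_iff_false, iff_false, not_lt]
    by_cases hxA : x ∈ A
    · rw [Set.indicator_of_notMem (by simpa using hxA)]; simp
    · rw [Set.indicator_of_mem (by simpa using hxA)]
      rw [hA] at hxA
      exact (not_lt.1 hxA).trans (not_lt.1 hrs)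

theorem rearrangement_le_add {f₀ f₁ : Space n → ℂ} (h : f =ᵐ[volume] f₀ + f₁) {c : ℝ≥0∞}
    (h₀ : ∀ᵐ x, ‖f₀ x‖ₑ ≤ c) (u : ℝ) : rearrangement f u ≤ c + rearrangement f₁ u := by
  refine rearrangement_le_iff.2 
    (le_trans (measure_mono_ae ?_) (rearrangement_le_iff.1 (le_refl (rearrangement f₁ u))))
  filter_upwards [h, h₀] with x hx hx0 hlt
  change c + rearrangement f₁ u < ‖f x‖ₑ at hlt
  change rearrangement f₁ u < ‖f₁ x‖ₑ
  by_contra hcon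
  refine absurd hlt (not_lt.2 ?_)
  rw [hx]
  exact (enorm_add_le _ _).trans (add_le_add hx0 (not_lt.1 hcon))

/-- Chebyshev's inequality at a level just below $f^*(u)$, where the superlevel set has measure
greater than $u$. -/
theorem rearrangement_le_eLpNorm_two (hf : AEStronglyMeasurable f volume) {u : ℝ} (hu : 0 < u) :
    rearrangement f u ≤ eLpNorm f 2 volume * ENNReal.ofReal (u ^ (-(1 / 2) : ℝ)) := by
  refine le_of_forall_lt fun r hr => ?_
  obtain ⟨r', hrr', hr'⟩ := exists_between hr
  refine lt_of_lt_of_le hrr' ?_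
  have h1 : ENNReal.ofReal u ≤ volume {x | r' < ‖f x‖ₑ} := (lt_rearrangement_iff.1 hr').le
  have h2 : r' ^ (2 : ℝ) * ENNReal.ofReal u ≤ ∫⁻ x, ‖f x‖ₑ ^ (2 : ℝ) := by
    calc r' ^ (2 : ℝ) * ENNReal.ofReal u
        ≤ r' ^ (2 : ℝ) * volume {x | r' ^ (2 : ℝ) ≤ ‖f x‖ₑ ^ (2 : ℝ)} := by
          gcongr
          refine h1.trans (measure_mono fun x hx => ?_)
          exact ENNReal.rpow_le_rpow (le_of_lt hx) zero_le_two
      _ ≤ _ := mul_meas_ge_le_lintegral₀ (hf.enorm.pow_const _) _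
  have h3 : eLpNorm f 2 volume = (∫⁻ x, ‖f x‖ₑ ^ (2 : ℝ)) ^ (1 / 2 : ℝ) := by
    rw [eLpNorm_eq_lintegral_rpow_enorm_toReal two_ne_zero ENNReal.ofNat_ne_top]
    simp
  have h4 := ENNReal.rpow_le_rpow h2 (z := 1 / 2) (by norm_num)
  rw [← h3, ENNReal.mul_rpow_of_nonneg _ _ (by norm_num), ← ENNReal.rpow_mul] at h4
  norm_num at h4
  calc r' = r' * ENNReal.ofReal u ^ (1 / 2 : ℝ) * ENNReal.ofReal (u ^ (-(1 / 2) : ℝ)) := by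
        rw [mul_assoc, ENNReal.ofReal_rpow_of_pos hu, ← ENNReal.ofReal_mul (by positivity),
          ← Real.rpow_add hu]
        simp
    _ ≤ _ := by gcongr

/-- The bounded part raises the rearrangement by at most $c$. The square integrable part contributes
a multiple of $u^{-1/2}$, whose average over $(0,t)$ is $2t^{-1/2}$. -/
theorem maximalRearrangement_le_add {f₀ f₁ : Space n → ℂ} (h : f =ᵐ[volume] f₀ + f₁) {c : ℝ≥0∞}
    (h₀ : ∀ᵐ x, ‖f₀ x‖ₑ ≤ c) (h₁ : AEStronglyMeasurable f₁ volume) {t : ℝ} (ht : 0 < t) :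
    maximalRearrangement f t ≤
      c + 2 * ENNReal.ofReal (t ^ (-(1 / 2) : ℝ)) * eLpNorm f₁ 2 volume := by
  rw [maximalRearrangement_le_iff ht]
  have hint : ∫⁻ u in Set.Ioo (0 : ℝ) t, ENNReal.ofReal (u ^ (-(1 / 2) : ℝ)) =
      ENNReal.ofReal (2 * t ^ (1 / 2 : ℝ)) := by
    rw [← ofReal_integral_eq_lintegral_ofReal, ← integral_Ioc_eq_integral_Ioo,
      ← intervalIntegral.integral_of_le ht.le, integral_rpow (Or.inl (by norm_num))]
    · congr 1
      norm_num
      ring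
    · exact (intervalIntegral.integrableOn_Ioo_rpow_iff ht).2 (by norm_num)
    · refine ae_restrict_of_forall_mem measurableSet_Ioo fun u hu => ?_
      exact Real.rpow_nonneg hu.1.le _
  calc ∫⁻ u in Set.Ioo (0 : ℝ) t, rearrangement f u
      ≤ ∫⁻ u in Set.Ioo (0 : ℝ) t,
          (c + eLpNorm f₁ 2 volume * ENNReal.ofReal (u ^ (-(1 / 2) : ℝ))) := by
        refine setLIntegral_mono' measurableSet_Ioo fun u hu => ?_
        exact (rearrangement_le_add h h₀ u).trans
          (by gcongr; exact rearrangement_le_eLpNorm_two h₁ hu.1)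
    _ = c * ENNReal.ofReal t + eLpNorm f₁ 2 volume * ENNReal.ofReal (2 * t ^ (1 / 2 : ℝ)) := by
        rw [lintegral_add_left measurable_const, setLIntegral_const, Real.volume_Ioo, sub_zero,
          lintegral_const_mul _ (by fun_prop), hint]
    _ = _ := by
        have : (2 : ℝ≥0∞) * ENNReal.ofReal (t ^ (-(1 / 2) : ℝ)) * ENNReal.ofReal t =
            ENNReal.ofReal (2 * t ^ (1 / 2 : ℝ)) := by
          rw [show (2 : ℝ≥0∞) = ENNReal.ofReal 2 by simp, ← ENNReal.ofReal_mul (by norm_num),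
            ← ENNReal.ofReal_mul (by positivity)]
          congr 1
          rw [mul_assoc]
          nth_rw 2 [← Real.rpow_one t]
          rw [← Real.rpow_add ht]
          norm_num
        rw [← this]
        ring

theorem lintegral_Ioi_rearrangement_sq_le {s : ℝ} (hs : 0 < s) :
    ∫⁻ u in Set.Ioi s, rearrangement f u ^ (2 : ℝ) ≤
      ∑' k : ℕ, ENNReal.ofReal (2 ^ k * s) * rearrangement f (2 ^ k * s) ^ (2 : ℝ) := by
  have hsub : Set.Ioi s ⊆ ⋃ k : ℕ, Set.Ico (2 ^ k * s) (2 ^ (k + 1) * s) := by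
    intro u hu
    obtain ⟨k, hk1, hk2⟩ := exists_nat_pow_near (x := u / s) (y := (2 : ℝ)) (by
      rw [le_div_iff₀ hs, one_mul]; exact le_of_lt hu) one_lt_two
    rw [le_div_iff₀ hs] at hk1
    rw [div_lt_iff₀ hs] at hk2
    exact Set.mem_iUnion.2 ⟨k, hk1, hk2⟩
  calc ∫⁻ u in Set.Ioi s, rearrangement f u ^ (2 : ℝ)
      ≤ ∫⁻ u in ⋃ k : ℕ, Set.Ico (2 ^ k * s) (2 ^ (k + 1) * s), rearrangement f u ^ (2 : ℝ) :=
        lintegral_mono_set hsub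
    _ ≤ ∑' k : ℕ, ∫⁻ u in Set.Ico (2 ^ k * s) (2 ^ (k + 1) * s), rearrangement f u ^ (2 : ℝ) :=
        lintegral_iUnion_le _ _
    _ ≤ _ := by
        refine ENNReal.tsum_le_tsum fun k => ?_
        calc ∫⁻ u in Set.Ico (2 ^ k * s) (2 ^ (k + 1) * s), rearrangement f u ^ (2 : ℝ)
            ≤ ∫⁻ u in Set.Ico (2 ^ k * s) (2 ^ (k + 1) * s),
                rearrangement f (2 ^ k * s) ^ (2 : ℝ) :=
              setLIntegral_mono measurable_const fun u hu =>
                ENNReal.rpow_le_rpow (rearrangement_antitone hu.1) zero_le_two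
          _ = _ := by
              rw [setLIntegral_const, Real.volume_Ico, mul_comm]
              congr 2
              ring

/-- The range $u\le s$ contributes at most $s f^*(s)^2$, which is the term $k=0$; the range $u>s$ is
covered by dyadic blocks on which $f^*$ is largest at the left endpoint. Hence the factor 2. -/
theorem lintegral_min_rearrangement_sq_le {s : ℝ} (hs : 0 < s) :
    ∫⁻ u in Set.Ioi (0 : ℝ), (min (rearrangement f u) (rearrangement f s)) ^ (2 : ℝ) ≤
      2 * ∑' k : ℕ, ENNReal.ofReal (2 ^ k * s) * rearrangement f (2 ^ k * s) ^ (2 : ℝ) := by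
  rw [two_mul, ← Set.Ioc_union_Ioi_eq_Ioi hs.le]
  refine (lintegral_union_le _ _ _).trans (add_le_add ?_ ?_)
  · refine le_trans ?_ (ENNReal.le_tsum 0)
    calc _ ≤ ∫⁻ u in Set.Ioc (0 : ℝ) s, rearrangement f s ^ (2 : ℝ) :=
          setLIntegral_mono measurable_const fun u hu =>
            ENNReal.rpow_le_rpow (min_le_right _ _) zero_le_two
      _ = _ := by
          rw [setLIntegral_const, Real.volume_Ioc, mul_comm]
          simp
  · refine le_trans (setLIntegral_mono (measurable_rearrangement.pow_const _) fun u hu => ?_)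
      (lintegral_Ioi_rearrangement_sq_le hs)
    exact ENNReal.rpow_le_rpow (min_le_left _ _) zero_le_two

theorem tsum_rpow_two_le (a : ℕ → ℝ≥0∞) : ∑' k, a k ^ (2 : ℝ) ≤ (∑' k, a k) ^ (2 : ℝ) := by
  calc ∑' k, a k ^ (2 : ℝ) ≤ ∑' k, a k * ∑' j, a j := by
        refine ENNReal.tsum_le_tsum fun k => ?_
        rw [ENNReal.rpow_two, sq]
        gcongr
        exact ENNReal.le_tsum k
    _ = _ := by rw [ENNReal.tsum_mul_right, ENNReal.rpow_two, sq]

/-- Passing from the square sum to the plain sum ($\ell^1\subset\ell^2$) makes the bound linear in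
$f^*$, as the Jensen argument later needs. The factor $\sqrt2$ is rounded up to 2. -/
theorem eLpNorm_two_indicator_le {A : Set (Space n)} {s : ℝ} (hs : 0 < s)
    (hA : A = {x | rearrangement f s < ‖f x‖ₑ})
    (hf : AEStronglyMeasurable (Aᶜ.indicator f) volume) :
    eLpNorm (Aᶜ.indicator f) 2 volume ≤
      2 * ∑' k : ℕ, ENNReal.ofReal ((2 ^ k * s) ^ (1 / 2 : ℝ)) * rearrangement f (2 ^ k * s) := by
  have h3 : eLpNorm (Aᶜ.indicator f) 2 volume =
      (∫⁻ x, ‖Aᶜ.indicator f x‖ₑ ^ (2 : ℝ)) ^ (1 / 2 : ℝ) := by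
    rw [eLpNorm_eq_lintegral_rpow_enorm_toReal two_ne_zero ENNReal.ofNat_ne_top]
    simp
  rw [h3, one_div, ENNReal.rpow_inv_le_iff two_pos, ENNReal.mul_rpow_of_nonneg _ _ zero_le_two]
  refine (lintegral_enorm_sq_indicator_le hA hf).trans
    ((lintegral_min_rearrangement_sq_le hs).trans ?_)
  refine mul_le_mul' ?_ (le_trans (le_of_eq ?_) (tsum_rpow_two_le _))
  · norm_num
  · refine tsum_congr fun k => ?_
    rw [ENNReal.mul_rpow_of_nonneg _ _ zero_le_two,
      ENNReal.ofReal_rpow_of_nonneg (by positivity) zero_le_two, ← Real.rpow_mul (by positivity)]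
    norm_num

end Rearrangement

/-! ### Integral inequalities for the measure $dt/t$ -/

section Hardy

/-- The measure `dt / t` on `(0, ∞)` is invariant under `t ↦ c / t`. -/
theorem lintegral_Ioi_comp_div {c : ℝ} (hc : 0 < c) (g : ℝ → ℝ≥0∞) :
    ∫⁻ t in Set.Ioi (0 : ℝ), g (c / t) * (ENNReal.ofReal t)⁻¹ =
      ∫⁻ t in Set.Ioi (0 : ℝ), g t * (ENNReal.ofReal t)⁻¹ := by
  have himg : (fun t : ℝ => c / t) '' Set.Ioi 0 = Set.Ioi 0 := by
    ext u
    constructor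
    · rintro ⟨t, ht, rfl⟩
      exact div_pos hc ht
    · intro hu
      have hu' : (0 : ℝ) < u := hu
      exact ⟨c / u, div_pos hc hu', by field_simp⟩
  have hder : ∀ t ∈ Set.Ioi (0 : ℝ),
      HasDerivWithinAt (fun t : ℝ => c / t) (-(c / t ^ 2)) (Set.Ioi 0) t := by
    intro t ht
    have ht' : t ≠ 0 := (show (0 : ℝ) < t from ht).ne'
    have := ((hasDerivAt_inv ht').const_mul c).hasDerivWithinAt (s := Set.Ioi 0)
    simpa [div_eq_mul_inv] using this
  have hinj : Set.InjOn (fun t : ℝ => c / t) (Set.Ioi 0) := by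
    intro a ha b hb hab
    have ha' : a ≠ 0 := (show (0 : ℝ) < a from ha).ne'
    have hb' : b ≠ 0 := (show (0 : ℝ) < b from hb).ne'
    simp only at hab
    field_simp at hab
    exact hab.symm
  have key := lintegral_image_eq_lintegral_abs_deriv_mul measurableSet_Ioi hder hinj
    (fun t => g t * (ENNReal.ofReal t)⁻¹)
  rw [himg] at key
  rw [key]
  refine setLIntegral_congr_fun measurableSet_Ioi fun t ht => ?_
  have ht' : (0 : ℝ) < t := ht
  rw [← ENNReal.ofReal_inv_of_pos ht', ← ENNReal.ofReal_inv_of_pos (div_pos hc ht'), abs_neg,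
    abs_of_pos (by positivity), mul_left_comm, ← ENNReal.ofReal_mul (by positivity)]
  congr 2
  field_simp

/-- Jensen's inequality for series with non-negative weights. -/
theorem tsum_mul_rpow_le (w z : ℕ → ℝ≥0∞) {q : ℝ} (hq : 1 ≤ q) :
    (∑' k, w k * z k) ^ q ≤ (∑' k, w k) ^ (q - 1) * ∑' k, w k * z k ^ q := by
  have hq0 : 0 < q := by linarith
  have hq1 : q⁻¹ ≤ 1 := inv_le_one_of_one_le₀ hq
  have key : ∑' k, w k * z k ≤ (∑' k, w k) ^ (1 - q⁻¹) * (∑' k, w k * z k ^ q) ^ q⁻¹ := by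
    rw [ENNReal.tsum_eq_iSup_sum (f := fun k => w k * z k)]
    refine iSup_le fun s => (ENNReal.inner_le_weight_mul_Lp_of_nonneg s hq w z).trans ?_
    refine mul_le_mul' (ENNReal.rpow_le_rpow (ENNReal.sum_le_tsum s) (by linarith))
      (ENNReal.rpow_le_rpow (ENNReal.sum_le_tsum s) (by positivity))
  refine (ENNReal.rpow_le_rpow key hq0.le).trans_eq ?_
  rw [ENNReal.mul_rpow_of_nonneg _ _ hq0.le, ← ENNReal.rpow_mul, ← ENNReal.rpow_mul,
    inv_mul_cancel₀ hq0.ne', ENNReal.rpow_one, sub_mul, inv_mul_cancel₀ hq0.ne', one_mul]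

theorem mul_maximalRearrangement_mono {n : ℕ} {f : Space n → ℂ} {t u : ℝ} (ht : 0 < t)
    (htu : t ≤ u) : ENNReal.ofReal t * maximalRearrangement f t ≤
      ENNReal.ofReal u * maximalRearrangement f u := by
  rw [mul_maximalRearrangement ht, mul_maximalRearrangement (ht.trans_le htu)]
  exact lintegral_mono_set (Set.Ioo_subset_Ioo_right htu)

/-- Finiteness of the Lorentz norm gives the weak-type bound. -/
theorem exists_forall_rpow_mul_maximalRearrangement_le {n : ℕ} {f : Space n → ℂ} {p : ℝ}
    (hp : 1 < p) {d : ℝ≥0∞} (hd : 1 ≤ d) (hf : lorentzNorm p d f < ∞) :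
    ∃ B : ℝ≥0∞, B ≠ ∞ ∧ ∀ t : ℝ, 0 < t →
      ENNReal.ofReal (t ^ (1 / p)) * maximalRearrangement f t ≤ B := by
  rcases eq_or_ne d ∞ with rfl | hd'
  · refine ⟨lorentzNorm p ∞ f, hf.ne, fun t ht => ?_⟩
    rw [lorentzNorm, if_pos rfl]
    exact le_iSup₂ (f := fun (t : ℝ) (_ : 0 < t) =>
      ENNReal.ofReal (t ^ (1 / p)) * maximalRearrangement f t) t ht
  have hq : 1 ≤ d.toReal := by
    rw [← ENNReal.toReal_one]; exact ENNReal.toReal_mono hd' hd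
  set q := d.toReal
  have hq0 : 0 < q := by linarith
  have hp0 : 0 < p := by linarith
  set I := ∫⁻ t in Set.Ioi (0 : ℝ), (ENNReal.ofReal (t ^ (1 / p)) * maximalRearrangement f t) ^ q *
    (ENNReal.ofReal t)⁻¹ with hI
  have hIfin : I ≠ ∞ := by
    intro hI'
    rw [lorentzNorm, if_neg hd', ← hI, hI', ENNReal.mul_top (by simp; positivity),
      ENNReal.top_rpow_of_pos (by positivity)] at hf
    exact lt_irrefl _ hf
  -- On $(t,2t]$ the function $u^{1/p}f^{**}(u)$ stays above half its value at $t$, because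
  -- $uf^{**}(u)$ increases. With $1/u\ge 1/(2t)$ this interval contributes at least
  -- $\frac12(G/2)^q$ to $I$.
  refine ⟨2 * (2 * I) ^ (1 / q), by finiteness, fun t ht => ?_⟩
  set G := ENNReal.ofReal (t ^ (1 / p)) * maximalRearrangement f t with hG
  have hlow : ∀ u ∈ Set.Ioc t (2 * t), (2⁻¹ * G) ^ q * (ENNReal.ofReal (2 * t))⁻¹ ≤
      (ENNReal.ofReal (u ^ (1 / p)) * maximalRearrangement f u) ^ q * (ENNReal.ofReal u)⁻¹ := by
    intro u hu
    have hu0 : 0 < u := ht.trans hu.1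
    refine mul_le_mul' (ENNReal.rpow_le_rpow ?_ hq0.le)
      (ENNReal.inv_le_inv.2 (ENNReal.ofReal_le_ofReal hu.2))
    · have h1 : maximalRearrangement f t ≤ 2 * maximalRearrangement f u := by
        have := mul_maximalRearrangement_mono (f := f) ht hu.1.le
        rw [← ENNReal.mul_le_mul_iff_right (a := ENNReal.ofReal t) (by simpa using ht)
          ENNReal.ofReal_ne_top, ← mul_assoc]
        refine this.trans ?_
        gcongr
        rw [show (2 : ℝ≥0∞) = ENNReal.ofReal 2 by simp, ← ENNReal.ofReal_mul ht.le]
        exact ENNReal.ofReal_le_ofReal (by linarith [hu.2])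
      calc 2⁻¹ * G ≤ 2⁻¹ * (ENNReal.ofReal (u ^ (1 / p)) * (2 * maximalRearrangement f u)) := by
            rw [hG]
            gcongr
            exact hu.1.le
        _ = (2⁻¹ * 2) * (ENNReal.ofReal (u ^ (1 / p)) * maximalRearrangement f u) := by ring
        _ = _ := by rw [ENNReal.inv_mul_cancel two_ne_zero ENNReal.ofNat_ne_top, one_mul]
  have hle : (2⁻¹ * G) ^ q * 2⁻¹ ≤ I := by
    calc (2⁻¹ * G) ^ q * 2⁻¹
        = ∫⁻ u in Set.Ioc t (2 * t), (2⁻¹ * G) ^ q * (ENNReal.ofReal (2 * t))⁻¹ := by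
          rw [setLIntegral_const, Real.volume_Ioc, mul_assoc,
            ← ENNReal.ofReal_inv_of_pos (by positivity), ← ENNReal.ofReal_mul (by positivity),
            show (2 : ℝ≥0∞)⁻¹ = ENNReal.ofReal 2⁻¹ by
              rw [ENNReal.ofReal_inv_of_pos two_pos]; simp]
          congr 2
          field_simp
          ring
      _ ≤ ∫⁻ u in Set.Ioc t (2 * t), (ENNReal.ofReal (u ^ (1 / p)) * maximalRearrangement f u) ^ q *
            (ENNReal.ofReal u)⁻¹ := setLIntegral_mono' measurableSet_Ioc hlow
      _ ≤ I := lintegral_mono_set fun u hu => ht.trans hu.1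
  have h2 : (2⁻¹ * G) ^ q ≤ 2 * I := by
    calc (2⁻¹ * G) ^ q = 2 * ((2⁻¹ * G) ^ q * 2⁻¹) := by
          generalize (2⁻¹ * G) ^ q = x
          rw [mul_left_comm, ENNReal.mul_inv_cancel two_ne_zero ENNReal.ofNat_ne_top, mul_one]
      _ ≤ _ := by gcongr
  have h3 : 2⁻¹ * G ≤ (2 * I) ^ (1 / q) := by
    rw [one_div]
    exact (ENNReal.le_rpow_inv_iff hq0).2 h2
  calc G = 2 * (2⁻¹ * G) := by
        rw [← mul_assoc, ENNReal.mul_inv_cancel two_ne_zero ENNReal.ofNat_ne_top, one_mul]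
    _ ≤ _ := by gcongr

/-- A weighted sum of reflected dilates is bounded on $L^q(dt/t)$ by its total weight: Jensen moves
the power inside the sum, and each $t\mapsto c_k/t$ preserves $dt/t$. The factor $p'/p$ compensates
for the different normalisations of the two norms. -/
theorem lorentzNorm_le_of_rpow_mul_maximalRearrangement_le {n : ℕ} {f g : Space n → ℂ}
    {p p' : ℝ} (hp : 0 < p) (hpp' : p ≤ p') {d : ℝ≥0∞} (hd : 1 ≤ d) {w : ℕ → ℝ≥0∞} {c : ℕ → ℝ}
    (hc : ∀ k, 0 < c k) (hw0 : ∑' k, w k ≠ 0) (hw : ∑' k, w k ≠ ∞) {B : ℝ≥0∞}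
    (H : ∀ t : ℝ, 0 < t → ENNReal.ofReal (t ^ (1 / p')) * maximalRearrangement g t ≤
      B * ∑' k, w k * (ENNReal.ofReal ((c k / t) ^ (1 / p)) * maximalRearrangement f (c k / t))) :
    lorentzNorm p' d g ≤
      B * (∑' k, w k) * ENNReal.ofReal (p' / p) * lorentzNorm p d f := by
  set W := ∑' k, w k with hW
  have hp' : 0 < p' := hp.trans_le hpp'
  have hratio : 1 ≤ p' / p := (one_le_div hp).2 hpp'
  rcases eq_or_ne d ∞ with rfl | hd'
  · rw [lorentzNorm, lorentzNorm, if_pos rfl, if_pos rfl]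
    set N := ⨆ (t : ℝ) (_ : 0 < t), ENNReal.ofReal (t ^ (1 / p)) * maximalRearrangement f t
    refine iSup₂_le fun t ht => (H t ht).trans ?_
    calc B * ∑' k, w k * (ENNReal.ofReal ((c k / t) ^ (1 / p)) * maximalRearrangement f (c k / t))
        ≤ B * ∑' k, w k * N := by
          gcongr with k
          exact le_iSup₂ (f := fun (t : ℝ) (_ : 0 < t) =>
            ENNReal.ofReal (t ^ (1 / p)) * maximalRearrangement f t) _ (div_pos (hc k) ht)
      _ = B * W * 1 * N := by rw [ENNReal.tsum_mul_right, mul_one, mul_assoc]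
      _ ≤ _ := by
          gcongr
          simpa using hratio
  have hq : 1 ≤ d.toReal := by
    rw [← ENNReal.toReal_one]; exact ENNReal.toReal_mono hd' hd
  rw [lorentzNorm, lorentzNorm, if_neg hd', if_neg hd']
  set q := d.toReal
  have hq0 : 0 < q := by linarith
  set G : ℝ → ℝ≥0∞ := fun t => (ENNReal.ofReal (t ^ (1 / p)) * maximalRearrangement f t) ^ q with hG
  have hGm : Measurable G := by
    refine Measurable.pow_const (Measurable.mul ?_ measurable_maximalRearrangement) _
    fun_prop
  have hint : ∫⁻ t in Set.Ioi (0 : ℝ), (ENNReal.ofReal (t ^ (1 / p')) * maximalRearrangement g t) ^ q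
      * (ENNReal.ofReal t)⁻¹ ≤
      (B * W) ^ q * ∫⁻ t in Set.Ioi (0 : ℝ), G t * (ENNReal.ofReal t)⁻¹ := by
    calc ∫⁻ t in Set.Ioi (0 : ℝ), (ENNReal.ofReal (t ^ (1 / p')) * maximalRearrangement g t) ^ q
          * (ENNReal.ofReal t)⁻¹
        ≤ ∫⁻ t in Set.Ioi (0 : ℝ), ∑' k, B ^ q * W ^ (q - 1) * w k *
            (G (c k / t) * (ENNReal.ofReal t)⁻¹) := by
          refine setLIntegral_mono' measurableSet_Ioi fun t ht => ?_
          calc _ ≤ (B * ∑' k, w k * (ENNReal.ofReal ((c k / t) ^ (1 / p)) *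
                    maximalRearrangement f (c k / t))) ^ q * (ENNReal.ofReal t)⁻¹ := by
                exact mul_le_mul' (ENNReal.rpow_le_rpow (H t ht) hq0.le) le_rfl
            _ ≤ B ^ q * (W ^ (q - 1) * ∑' k, w k * G (c k / t)) * (ENNReal.ofReal t)⁻¹ := by
                rw [ENNReal.mul_rpow_of_nonneg _ _ hq0.le]
                gcongr
                exact tsum_mul_rpow_le _ _ hq
            _ = _ := by
                rw [← ENNReal.tsum_mul_left, ← ENNReal.tsum_mul_left, ← ENNReal.tsum_mul_right]
                refine tsum_congr fun k => ?_
                ring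
      _ = ∑' k, B ^ q * W ^ (q - 1) * w k *
            ∫⁻ t in Set.Ioi (0 : ℝ), G t * (ENNReal.ofReal t)⁻¹ := by
          have hm : ∀ k, Measurable fun t : ℝ => G (c k / t) * (ENNReal.ofReal t)⁻¹ := fun k =>
            (hGm.comp (measurable_const.div measurable_id)).mul ENNReal.measurable_ofReal.inv
          rw [lintegral_tsum fun k => ((hm k).const_mul _).aemeasurable]
          refine tsum_congr fun k => ?_
          rw [lintegral_const_mul _ (hm k), lintegral_Ioi_comp_div (hc k)]
      _ = _ := by
          rw [ENNReal.tsum_mul_right, ENNReal.tsum_mul_left, ← hW,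
            ENNReal.mul_rpow_of_nonneg _ _ hq0.le, mul_assoc (B ^ q)]
          congr 2
          nth_rw 2 [← ENNReal.rpow_one W]
          rw [← ENNReal.rpow_add _ _ hw0 hw, sub_add_cancel]
  set I := ∫⁻ t in Set.Ioi (0 : ℝ), G t * (ENNReal.ofReal t)⁻¹ with hI
  calc _ ≤ (ENNReal.ofReal (p' / q) * ((B * W) ^ q * I)) ^ (1 / q) := by gcongr
    _ = ((B * W) ^ q * (ENNReal.ofReal (p' / p) * (ENNReal.ofReal (p / q) * I))) ^ (1 / q) := by
        rw [← mul_assoc (ENNReal.ofReal (p' / p)), ← ENNReal.ofReal_mul (by positivity),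
          show p' / p * (p / q) = p' / q by field_simp]
        congr 1
        ring
    _ = B * W * (ENNReal.ofReal (p' / p)) ^ (1 / q) * (ENNReal.ofReal (p / q) * I) ^ (1 / q) := by
        rw [ENNReal.mul_rpow_of_nonneg ((B * W) ^ q) _ (by positivity),
          ENNReal.mul_rpow_of_nonneg (ENNReal.ofReal (p' / p)) _ (by positivity), ← ENNReal.rpow_mul,
          mul_one_div_cancel hq0.ne', ENNReal.rpow_one, mul_assoc (B * W)]
    _ ≤ _ := by
        gcongr
        -- The exact factor is $(p'/p)^{1/q}$; since $p'/p\ge1$ and $1/q\le1$, it has a bound free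
        -- of $q$.
        calc _ ≤ ENNReal.ofReal (p' / p) ^ (1 : ℝ) :=
              ENNReal.rpow_le_rpow_of_exponent_le (by simpa using hratio)
                (by rw [div_le_one hq0]; exact hq)
          _ = _ := ENNReal.rpow_one _

end Hardy

/-! ### The Schrödinger kernel as a limit of complex Gaussians -/

section Kernel

open FourierTransform Filter Topology

variable {n : ℕ}

/-- The free Schrödinger kernel, written as a Gaussian of complex width: the heat kernel has the
Fourier transform `exp (-b‖ξ‖²)`, and `b = it(2π)²` for the Schrödinger group. -/
noncomputable def gaussianKernel (b : ℂ) (z : Space n) : ℂ :=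
  (Real.pi / b) ^ ((n : ℂ) / 2) * Complex.exp (-Real.pi ^ 2 * ‖z‖ ^ 2 / b)

theorem norm_gaussianKernel_le {b : ℂ} (hb : 0 ≤ b.re) (z : Space n) :
    ‖gaussianKernel b z‖ ≤ (Real.pi / ‖b‖) ^ ((n : ℝ) / 2) := by
  rw [gaussianKernel, norm_mul,
    show (n : ℂ) / 2 = (((n : ℝ) / 2 : ℝ) : ℂ) by push_cast; rfl, Complex.norm_cpow_real,
    Complex.norm_exp, norm_div, Complex.norm_of_nonneg Real.pi_pos.le]
  refine mul_le_of_le_one_right (by positivity) (Real.exp_le_one_iff.2 ?_)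
  have : -(Real.pi : ℂ) ^ 2 * (‖z‖ : ℂ) ^ 2 / b = ((-(Real.pi ^ 2 * ‖z‖ ^ 2) : ℝ) : ℂ) * b⁻¹ := by
    push_cast
    ring
  rw [this, Complex.re_ofReal_mul, Complex.inv_re, neg_mul]
  exact neg_nonpos.2 (mul_nonneg (by positivity) (div_nonneg hb (Complex.normSq_nonneg _)))

theorem continuous_gaussianKernel (b : ℂ) : Continuous (gaussianKernel (n := n) b) := by
  unfold gaussianKernel
  fun_prop

/-- For positive real part the Gaussian is integrable, so the multiplication formula moves the
Fourier transform from $u$ to the Gaussian, where it is explicit. -/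
theorem integral_fourierChar_mul_gaussian {b : ℂ} (hb : 0 < b.re) (u : 𝓢(Space n, ℂ))
    (x : Space n) :
    𝓕 (fun ξ : Space n => Complex.exp (-b * ‖ξ‖ ^ 2) * 𝓕⁻ (u : Space n → ℂ) ξ) x =
      ∫ y, gaussianKernel b (x - y) * u y := by
  -- The character at $x$ is absorbed into the Gaussian, so its Fourier transform is a translated
  -- kernel.
  set h : Space n → ℂ := fun ξ =>
    Complex.exp (-b * ‖ξ‖ ^ 2 + 2 * Real.pi * Complex.I * inner ℝ (-x) ξ) with hh
  have hint : Integrable h := GaussianFourier.integrable_cexp_neg_mul_sq_norm_add hb _ _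
  have hF : ∀ w, 𝓕 h w = gaussianKernel b (-x - w) := by
    intro w
    rw [hh, fourier_gaussian_innerProductSpace' hb, gaussianKernel]
    simp
  set v : Space n → ℂ := fun y => u (-y) with hv
  have hvint : Integrable v := (u.integrable (μ := volume)).comp_neg
  have hinv : ∀ ξ, 𝓕⁻ (u : Space n → ℂ) ξ = 𝓕 v ξ := by
    intro ξ
    rw [Real.fourierInv_eq_fourier_comp_neg]
  have hsa : ∫ ξ, 𝓕 v ξ • h ξ = ∫ y, v y • 𝓕 h y := by
    simpa using! VectorFourier.integral_fourierIntegral_smul_eq_flip (L := innerₗ (Space n))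
      Real.continuous_fourierChar continuous_inner hvint hint
  calc 𝓕 (fun ξ : Space n => Complex.exp (-b * ‖ξ‖ ^ 2) * 𝓕⁻ (u : Space n → ℂ) ξ) x
      = ∫ ξ, 𝓕 v ξ • h ξ := by
        rw [Real.fourier_eq']
        refine integral_congr_ae (Eventually.of_forall fun ξ => ?_)
        simp only [hinv, hh, smul_eq_mul, Complex.exp_add, inner_neg_left, real_inner_comm]
        push_cast
        ring_nf
    _ = ∫ y, v y • 𝓕 h y := hsa
    _ = ∫ y, v (-y) • 𝓕 h (-y) := (integral_neg_eq_self (fun y => v y • 𝓕 h y) volume).symm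
    _ = _ := by
        refine integral_congr_ae (Eventually.of_forall fun y => ?_)
        simp only [hF, hv, neg_neg, smul_eq_mul, gaussianKernel]
        rw [show -x - -y = -(x - y) by abel, norm_neg, mul_comm]

/-- The Gaussian width of the Schrödinger group. -/
noncomputable def schrodingerWidth (t : ℝ) : ℂ := ((t * (2 * Real.pi) ^ 2 : ℝ) : ℂ) * Complex.I

theorem schrodingerSymbol_eq (t : ℝ) (ξ : Space n) :
    schrodingerSymbol t ξ = Complex.exp (-schrodingerWidth t * ‖ξ‖ ^ 2) := by
  rw [schrodingerSymbol, schrodingerWidth]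
  congr 1
  push_cast
  ring

theorem norm_schrodingerSymbol (t : ℝ) (ξ : Space n) : ‖schrodingerSymbol t ξ‖ = 1 := by
  rw [schrodingerSymbol, Complex.norm_exp, Complex.neg_re, Complex.re_mul_ofReal, Complex.I_re,
    zero_mul, neg_zero, Real.exp_zero]

theorem schrodingerWidth_re (t : ℝ) : (schrodingerWidth t).re = 0 := by
  rw [schrodingerWidth, Complex.re_ofReal_mul, Complex.I_re, mul_zero]

theorem schrodingerWidth_im (t : ℝ) : (schrodingerWidth t).im = t * (2 * Real.pi) ^ 2 := by
  rw [schrodingerWidth, Complex.im_ofReal_mul, Complex.I_im, mul_one]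

theorem norm_schrodingerWidth (t : ℝ) : ‖schrodingerWidth t‖ = |t| * (2 * Real.pi) ^ 2 := by
  rw [schrodingerWidth, norm_mul, Complex.norm_I, mul_one, Complex.norm_real, Real.norm_eq_abs,
    abs_mul, abs_of_nonneg (a := (2 * Real.pi) ^ 2) (by positivity)]

/-- The constant of the dispersive estimate. -/
noncomputable def dispersiveConst (n : ℕ) (t : ℝ) : ℝ := (4 * Real.pi * |t|) ^ (-((n : ℝ) / 2))

theorem pi_div_norm_schrodingerWidth_rpow {t : ℝ} (ht : t ≠ 0) :
    (Real.pi / ‖schrodingerWidth t‖) ^ ((n : ℝ) / 2) = dispersiveConst n t := by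
  have ht' : 0 < |t| := abs_pos.2 ht
  have hpi := Real.pi_pos
  rw [dispersiveConst, Real.rpow_neg (by positivity), ← Real.inv_rpow (by positivity),
    norm_schrodingerWidth]
  congr 1
  field_simp
  ring

/-- The width is purely imaginary, so the Gaussian formula does not apply directly. It is used for
the width plus $\varepsilon>0$, and both sides pass to the limit by dominated convergence. -/
theorem fourier_schrodingerSymbol_mul {t : ℝ} (ht : t ≠ 0) (u : 𝓢(Space n, ℂ)) (x : Space n) :
    𝓕 (fun ξ : Space n => schrodingerSymbol t ξ * 𝓕⁻ (u : Space n → ℂ) ξ) x =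
      ∫ y, gaussianKernel (schrodingerWidth t) (x - y) * u y := by
  set b₀ := schrodingerWidth t with hb₀
  have hre : b₀.re = 0 := schrodingerWidth_re t
  have hb₀0 : b₀ ≠ 0 := by
    rw [← norm_ne_zero_iff, norm_schrodingerWidth]
    have := abs_pos.2 ht
    positivity
  set b : ℝ → ℂ := fun ε => ε + b₀ with hb
  have hbre : ∀ ε, (b ε).re = ε := fun ε => by simp [hb, hre]
  have hlimb : Tendsto b (𝓝[>] 0) (𝓝 b₀) := by
    have : Continuous b := by fun_prop
    simpa [hb] using (this.tendsto 0).mono_left nhdsWithin_le_nhds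
  -- Adding $\varepsilon$ leaves the imaginary part unchanged, so the kernels have a common bound as
  -- $\varepsilon\to0$.
  have hnorm : ∀ ε, ‖b₀‖ ≤ ‖b ε‖ := by
    intro ε
    have h1 : ‖b₀‖ = |(b ε).im| := by
      rw [norm_schrodingerWidth, hb, Complex.add_im, Complex.ofReal_im, zero_add,
        schrodingerWidth_im, abs_mul, abs_of_nonneg (a := (2 * Real.pi) ^ 2) (by positivity)]
    rw [h1]
    exact Complex.abs_im_le_norm _
  have hu : Integrable (fun y => u y) := u.integrable
  have hFu : Integrable (fun y => 𝓕⁻ (u : Space n → ℂ) y) := by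
    have := (𝓕⁻ u).integrable (μ := volume)
    rwa [SchwartzMap.fourierInv_coe] at this
  have hFc : Continuous (fun y => 𝓕⁻ (u : Space n → ℂ) y) := by
    have := (𝓕⁻ u).continuous
    rwa [SchwartzMap.fourierInv_coe] at this
  -- $\pi/b_0$ is a nonzero imaginary number, hence off the branch cut, and the complex power is
  -- continuous there.
  have hslit : Real.pi / b₀ ∈ Complex.slitPlane := by
    refine Complex.mem_slitPlane_iff.2 (Or.inr ?_)
    rw [Complex.div_im]
    simp only [Complex.ofReal_im, hre, Complex.ofReal_re]
    have him : b₀.im ≠ 0 := fun h => hb₀0 (Complex.ext hre h)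
    simpa using ⟨him, hb₀0⟩
  have hL : Tendsto (fun ε => 𝓕 (fun ξ : Space n =>
      Complex.exp (-b ε * ‖ξ‖ ^ 2) * 𝓕⁻ (u : Space n → ℂ) ξ) x) (𝓝[>] 0)
      (𝓝 (𝓕 (fun ξ : Space n => schrodingerSymbol t ξ * 𝓕⁻ (u : Space n → ℂ) ξ) x)) := by
    simp only [Real.fourier_eq', schrodingerSymbol_eq]
    refine tendsto_integral_filter_of_dominated_convergence (fun ξ => ‖𝓕⁻ (u : Space n → ℂ) ξ‖)
      ?_ ?_ hFu.norm ?_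
    · refine Eventually.of_forall fun ε => Continuous.aestronglyMeasurable ?_
      fun_prop
    · filter_upwards [self_mem_nhdsWithin] with ε hε
      refine Eventually.of_forall fun ξ => ?_
      rw [norm_smul, norm_mul, Complex.norm_exp_ofReal_mul_I, one_mul]
      refine mul_le_of_le_one_left (norm_nonneg _) ?_
      rw [Complex.norm_exp, Real.exp_le_one_iff]
      rw [show -b ε * (‖ξ‖ : ℂ) ^ 2 = ((-‖ξ‖ ^ 2 : ℝ) : ℂ) * b ε by push_cast; ring,
        Complex.re_ofReal_mul, hbre]
      have : (0 : ℝ) < ε := hε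
      nlinarith [sq_nonneg ‖ξ‖]
    · refine Eventually.of_forall fun ξ => ?_
      refine Tendsto.const_smul ?_ _
      refine Tendsto.mul_const _ ?_
      exact (Complex.continuous_exp.tendsto _).comp ((hlimb.neg).mul_const _)
  have hR : Tendsto (fun ε => ∫ y, gaussianKernel (b ε) (x - y) * u y) (𝓝[>] 0)
      (𝓝 (∫ y, gaussianKernel b₀ (x - y) * u y)) := by
    refine tendsto_integral_filter_of_dominated_convergence
      (fun y => (Real.pi / ‖b₀‖) ^ ((n : ℝ) / 2) * ‖u y‖) ?_ ?_ (hu.norm.const_mul _) ?_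
    · refine Eventually.of_forall fun ε => Continuous.aestronglyMeasurable ?_
      have := continuous_gaussianKernel (n := n) (b ε)
      fun_prop
    · filter_upwards [self_mem_nhdsWithin] with ε hε
      refine Eventually.of_forall fun y => ?_
      rw [norm_mul]
      gcongr
      refine (norm_gaussianKernel_le ((hbre ε).symm ▸ le_of_lt hε) _).trans ?_
      have := norm_pos_iff.2 hb₀0
      gcongr
      exact hnorm ε
    · refine Eventually.of_forall fun y => Tendsto.mul_const _ ?_
      refine Tendsto.mul ?_ ?_
      · exact (tendsto_const_nhds.div hlimb hb₀0).cpow tendsto_const_nhds hslit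
      · exact (Complex.continuous_exp.tendsto _).comp (tendsto_const_nhds.div hlimb hb₀0)
  refine tendsto_nhds_unique hL (hR.congr' ?_)
  filter_upwards [self_mem_nhdsWithin] with ε hε
  exact (integral_fourierChar_mul_gaussian ((hbre ε).symm ▸ hε) u x).symm

end Kernel

/-! ### Distributions given by functions, and the two endpoint estimates -/

section Distribution

open FourierTransform Filter

variable {n : ℕ} {T T₁ T₂ : 𝓢'(Space n, ℂ)} {f g f₁ f₂ : Space n → ℂ}

theorem IsGivenBy.add (h₁ : IsGivenBy T₁ f₁) (h₂ : IsGivenBy T₂ f₂) :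
    IsGivenBy (T₁ + T₂) (f₁ + f₂) := by
  refine ⟨h₁.1.add h₂.1, fun g => ?_⟩
  obtain ⟨hi₁, he₁⟩ := h₁.2 g
  obtain ⟨hi₂, he₂⟩ := h₂.2 g
  simp only [Pi.add_apply, mul_add]
  refine ⟨hi₁.add hi₂, ?_⟩
  rw [integral_add hi₁ hi₂, ← he₁, ← he₂]
  rfl

theorem IsGivenBy.congr_ae (h : IsGivenBy T f) (hfg : f =ᵐ[volume] g) : IsGivenBy T g := by
  refine ⟨fun x => (h.1 x).imp fun s hs => ⟨hs.1, ?_⟩, fun u => ?_⟩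
  · exact hs.2.congr_fun_ae (ae_restrict_of_ae hfg)
  · have hu : (fun x => u x * f x) =ᵐ[volume] fun x => u x * g x := by
      filter_upwards [hfg] with x hx
      rw [hx]
    exact ⟨(h.2 u).1.congr hu, (h.2 u).2.trans (integral_congr_ae hu)⟩

/-- Compactly supported smooth functions are Schwartz functions and already separate locally
integrable functions. -/
theorem IsGivenBy.ae_eq (hf : IsGivenBy T f) (hg : IsGivenBy T g) : f =ᵐ[volume] g := by
  refine ae_eq_of_integral_contDiff_smul_eq hf.1 hg.1 fun u hu hc => ?_
  have h₁ : HasCompactSupport (Complex.ofRealCLM ∘ u) := hc.comp_left rfl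
  have h₂ : ContDiff ℝ ((⊤ : ℕ∞) : WithTop ℕ∞) (Complex.ofRealCLM ∘ u) :=
    Complex.ofRealCLM.contDiff.comp hu
  have := (hf.2 (h₁.toSchwartzMap h₂)).2.symm.trans (hg.2 (h₁.toSchwartzMap h₂)).2
  simpa using this

theorem IsGivenBy.eq (h₁ : IsGivenBy T₁ f) (h₂ : IsGivenBy T₂ f) : T₁ = T₂ := by
  ext u
  rw [(h₁.2 u).2, (h₂.2 u).2]

theorem isGivenBy_toTemperedDistribution {p : ℝ≥0∞} [hp : Fact (1 ≤ p)]
    (f : Lp ℂ p (volume : Measure (Space n))) : IsGivenBy (Lp.toTemperedDistribution f) f := by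
  refine ⟨(Lp.memLp f).locallyIntegrable hp.out, fun u => ⟨?_, ?_⟩⟩
  · have := ENNReal.HolderConjugate.inv_one_sub_inv' hp.out
    exact MemLp.integrable_mul (u.memLp (1 - p⁻¹)⁻¹ volume) (Lp.memLp f)
  · simp

theorem _root_.MeasureTheory.MemLp.isGivenBy {p : ℝ≥0∞} [hp : Fact (1 ≤ p)]
    (hf : MemLp f p volume) : IsGivenBy (Lp.toTemperedDistribution hf.toLp) f :=
  (isGivenBy_toTemperedDistribution _).congr_ae hf.coeFn_toLp

theorem schrodingerGroup_apply (t : ℝ) (T : 𝓢'(Space n, ℂ)) (u : 𝓢(Space n, ℂ)) :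
    schrodingerGroup t T u =
      T (𝓕 (SchwartzMap.smulLeftCLM ℂ (schrodingerSymbol t) (𝓕⁻ u))) := rfl

/-- The Schrödinger group is bounded by one on `L²`. -/
theorem exists_isGivenBy_schrodingerGroup_of_memLp_two (t : ℝ) (hf : MemLp f 2 volume)
    (hT : IsGivenBy T f) : ∃ g : Space n → ℂ, MemLp g 2 volume ∧
      eLpNorm g 2 volume ≤ eLpNorm f 2 volume ∧ IsGivenBy (schrodingerGroup t T) g := by
  have hm := hasTemperateGrowth_schrodingerSymbol (n := n) t
  have hm2 : MemLp (schrodingerSymbol (n := n) t) ∞ volume :=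
    memLp_top_of_bound hm.1.continuous.aestronglyMeasurable 1
      (Eventually.of_forall fun ξ => (norm_schrodingerSymbol t ξ).le)
  set F : Lp ℂ 2 (volume : Measure (Space n)) := hf.toLp
  set G : Lp ℂ 2 (volume : Measure (Space n)) := 𝓕⁻ (hm2.toLp _ • 𝓕 F : Lp ℂ 2 volume) with hG
  have hTF : T = Lp.toTemperedDistribution F := hT.eq hf.isGivenBy
  have hSG : schrodingerGroup t T = Lp.toTemperedDistribution G := by
    rw [hTF, schrodingerGroup, TemperedDistribution.fourierMultiplierCLM_apply,
      Lp.fourier_toTemperedDistribution_eq,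
      ← Lp.toTemperedDistribution_smul_eq (p := ∞) (q := 2) (r := 2) hm hm2,
      Lp.fourierInv_toTemperedDistribution_eq]
  -- Plancherel on both sides, with a multiplier of modulus one in between.
  have hnorm : ‖G‖ ≤ ‖F‖ := by
    have h1 : ‖G‖ = ‖(hm2.toLp _ • 𝓕 F : Lp ℂ 2 (volume : Measure (Space n)))‖ := by
      rw [← Lp.norm_fourier_eq G, hG, fourier_fourierInv_eq]
    rw [h1]
    refine (Lp.norm_smul_le _ _).trans ?_
    rw [Lp.norm_fourier_eq]
    refine mul_le_of_le_one_left (norm_nonneg _) ?_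
    rw [Lp.norm_toLp]
    refine ENNReal.toReal_le_of_le_ofReal zero_le_one ?_
    rw [eLpNorm_exponent_top]
    exact eLpNormEssSup_le_of_ae_bound
      (Eventually.of_forall fun ξ => (norm_schrodingerSymbol t ξ).le)
  refine ⟨G, Lp.memLp G, ?_, hSG ▸ isGivenBy_toTemperedDistribution G⟩
  rw [Lp.norm_def, Lp.norm_def,
    ENNReal.toReal_le_toReal (Lp.eLpNorm_ne_top _) (Lp.eLpNorm_ne_top _)] at hnorm
  exact hnorm.trans (eLpNorm_congr_ae hf.coeFn_toLp).le

/-- The dispersive estimate. -/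
theorem exists_isGivenBy_schrodingerGroup_of_integrable {t : ℝ} (ht : t ≠ 0)
    (hf : Integrable f volume) (hT : IsGivenBy T f) : ∃ g : Space n → ℂ,
      (∀ x, ‖g x‖ₑ ≤ ENNReal.ofReal (dispersiveConst n t) * ∫⁻ x, ‖f x‖ₑ) ∧
      IsGivenBy (schrodingerGroup t T) g := by
  set k : Space n → ℂ := gaussianKernel (schrodingerWidth t) with hk
  have hkc : Continuous k := continuous_gaussianKernel _
  have hkn : ∀ z, ‖k z‖ ≤ dispersiveConst n t := by
    intro z
    rw [← pi_div_norm_schrodingerWidth_rpow ht]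
    exact norm_gaussianKernel_le (schrodingerWidth_re t).ge z
  have hkn' : ∀ z, ‖k z‖ₑ ≤ ENNReal.ofReal (dispersiveConst n t) := fun z => by
    rw [← ofReal_norm]
    exact ENNReal.ofReal_le_ofReal (hkn z)
  set g : Space n → ℂ := fun y => ∫ x, k (x - y) * f x with hg
  have hgn : ∀ y, ‖g y‖ₑ ≤ ENNReal.ofReal (dispersiveConst n t) * ∫⁻ x, ‖f x‖ₑ := by
    intro y
    calc ‖g y‖ₑ ≤ ∫⁻ x, ‖k (x - y) * f x‖ₑ := enorm_integral_le_lintegral_enorm _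
      _ ≤ ∫⁻ x, ENNReal.ofReal (dispersiveConst n t) * ‖f x‖ₑ := by
          refine lintegral_mono fun x => ?_
          rw [enorm_mul]
          gcongr
          exact hkn' _
      _ = _ := lintegral_const_mul' _ _ ENNReal.ofReal_ne_top
  have hgm : AEStronglyMeasurable g volume := by
    refine AEStronglyMeasurable.integral_prod_right' (f := fun z : Space n × Space n =>
      k (z.2 - z.1) * f z.2) ?_
    refine AEStronglyMeasurable.mul (Continuous.aestronglyMeasurable (by fun_prop)) ?_
    exact hf.1.comp_snd
  have hgmem : MemLp g ∞ volume := by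
    refine ⟨hgm, ?_⟩
    rw [eLpNorm_exponent_top]
    refine lt_of_le_of_lt (essSup_le_of_ae_le _ (Eventually.of_forall hgn)) ?_
    exact ENNReal.mul_lt_top ENNReal.ofReal_lt_top hf.2
  have hgiven := hgmem.isGivenBy
  refine ⟨g, hgn, ?_⟩
  -- The group acts on $T$ by transposition: on a test function it is integration against $k(x-y)$,
  -- and Fubini transfers this integral to $f$.
  suffices h : schrodingerGroup t T = Lp.toTemperedDistribution hgmem.toLp by rwa [h]
  ext u
  rw [(hgiven.2 u).2, schrodingerGroup_apply, (hT.2 _).2]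
  have hu : ∀ x, 𝓕 (SchwartzMap.smulLeftCLM ℂ (schrodingerSymbol t) (𝓕⁻ u)) x =
      ∫ y, k (x - y) * u y := by
    intro x
    rw [SchwartzMap.fourier_coe, ← fourier_schrodingerSymbol_mul ht u x]
    refine congrFun (congrArg 𝓕 (funext fun ξ => ?_)) x
    rw [SchwartzMap.smulLeftCLM_apply_apply (hasTemperateGrowth_schrodingerSymbol t),
      SchwartzMap.fourierInv_coe, smul_eq_mul]
  have hint : Integrable (Function.uncurry fun x y : Space n => k (x - y) * u y * f x)
      (volume.prod volume) := by
    have h1 : Integrable (fun z : Space n × Space n => f z.1 * u z.2) (volume.prod volume) :=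
      hf.mul_prod u.integrable
    have h2 := h1.bdd_mul (f := fun z : Space n × Space n => k (z.1 - z.2))
      (c := dispersiveConst n t) (Continuous.aestronglyMeasurable (by fun_prop))
      (Eventually.of_forall fun z => hkn _)
    refine h2.congr (Eventually.of_forall fun z => ?_)
    simp only [Function.uncurry]
    ring
  calc ∫ x, 𝓕 (SchwartzMap.smulLeftCLM ℂ (schrodingerSymbol t) (𝓕⁻ u)) x * f x
      = ∫ x, ∫ y, k (x - y) * u y * f x := by
        refine integral_congr_ae (Eventually.of_forall fun x => ?_)
        simp only [hu]
        exact (integral_mul_const _ _).symm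
    _ = ∫ y, ∫ x, k (x - y) * u y * f x := integral_integral_swap hint
    _ = _ := by
        refine integral_congr_ae (Eventually.of_forall fun y => ?_)
        simp only [hg]
        rw [← integral_const_mul]
        refine integral_congr_ae (Eventually.of_forall fun x => ?_)
        simp only
        ring

end Distribution

/-! ### Splitting the initial datum, and the pointwise interpolation bound -/

section Decomposition

variable {n : ℕ} {f ψ : Space n → ℂ} {p p' s : ℝ}

/-- A dyadic majorant of the averaging operators that occur in the interpolation between
`L¹ → L^∞` and `L² → L²`. -/
noncomputable def dyadicSum (p : ℝ) (f : Space n → ℂ) (s : ℝ) : ℝ≥0∞ :=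
  ∑' k : ℕ, ENNReal.ofReal ((2 ^ (1 / 2 - 1 / p : ℝ)) ^ k) *
    (ENNReal.ofReal ((2 ^ k * s) ^ (1 / p)) * maximalRearrangement f (2 ^ k * s))

theorem two_rpow_lt_one (hp0 : 0 < p) (hp : p < 2) : (2 : ℝ) ^ (1 / 2 - 1 / p : ℝ) < 1 := by
  refine Real.rpow_lt_one_of_one_lt_of_neg one_lt_two ?_
  have := one_div_lt_one_div_of_lt hp0 hp
  linarith

theorem tsum_dyadic_weight (hp0 : 0 < p) (hp : p < 2) :
    ∑' k : ℕ, ENNReal.ofReal (((2 : ℝ) ^ (1 / 2 - 1 / p : ℝ)) ^ k) =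
      ENNReal.ofReal (1 - (2 : ℝ) ^ (1 / 2 - 1 / p : ℝ))⁻¹ := by
  have h0 : (0 : ℝ) ≤ 2 ^ (1 / 2 - 1 / p : ℝ) := by positivity
  rw [← ENNReal.ofReal_tsum_of_nonneg (fun k => by positivity)
    (summable_geometric_of_lt_one h0 (two_rpow_lt_one hp0 hp)),
    tsum_geometric_of_lt_one h0 (two_rpow_lt_one hp0 hp)]

/-- The weak-type bound makes the terms at most a constant times a convergent geometric series;
convergence is where $p<2$ is needed. -/
theorem dyadicSum_lt_top (hp1 : 1 < p) (hp2 : p < 2) {d : ℝ≥0∞} (hd : 1 ≤ d)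
    (hf : lorentzNorm p d f < ∞) (hs : 0 < s) : dyadicSum p f s < ∞ := by
  obtain ⟨B, hB, h⟩ := exists_forall_rpow_mul_maximalRearrangement_le hp1 hd hf
  calc dyadicSum p f s
      ≤ ∑' k : ℕ, ENNReal.ofReal (((2 : ℝ) ^ (1 / 2 - 1 / p : ℝ)) ^ k) * B := by
        refine ENNReal.tsum_le_tsum fun k => ?_
        gcongr
        exact h _ (by positivity)
    _ < ∞ := by
        rw [ENNReal.tsum_mul_right, tsum_dyadic_weight (by linarith) hp2]
        exact ENNReal.mul_lt_top ENNReal.ofReal_lt_top hB.lt_top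

theorem mul_maximalRearrangement_le_dyadicSum (hs : 0 < s) :
    ENNReal.ofReal s * maximalRearrangement f s ≤
      ENNReal.ofReal (s ^ (1 - 1 / p)) * dyadicSum p f s := by
  have h : ENNReal.ofReal (s ^ (1 / p)) * maximalRearrangement f s ≤ dyadicSum p f s := by
    refine le_trans (le_of_eq ?_) (ENNReal.le_tsum 0)
    simp
  calc ENNReal.ofReal s * maximalRearrangement f s
      = ENNReal.ofReal (s ^ (1 - 1 / p)) *
          (ENNReal.ofReal (s ^ (1 / p)) * maximalRearrangement f s) := by
        rw [← mul_assoc, ← ENNReal.ofReal_mul (by positivity), ← Real.rpow_add hs,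
          sub_add_cancel, Real.rpow_one]
    _ ≤ _ := by gcongr

/-- Termwise, $(2^ks)^{1/2}=(2^ks)^{1/2-1/p}(2^ks)^{1/p}$; the first factor splits into the
geometric weight and a power of $s$, and $f^*\le f^{**}$. -/
theorem tsum_rpow_half_mul_rearrangement_le_dyadicSum (hs : 0 < s) :
    ∑' k : ℕ, ENNReal.ofReal ((2 ^ k * s) ^ (1 / 2 : ℝ)) * rearrangement f (2 ^ k * s) ≤
      ENNReal.ofReal (s ^ (1 / 2 - 1 / p)) * dyadicSum p f s := by
  rw [dyadicSum, ← ENNReal.tsum_mul_left]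
  refine ENNReal.tsum_le_tsum fun k => ?_
  have hk : (0 : ℝ) < 2 ^ k * s := by positivity
  rw [← mul_assoc, ← mul_assoc, ← ENNReal.ofReal_mul (by positivity),
    ← ENNReal.ofReal_mul (by positivity)]
  refine mul_le_mul' (ENNReal.ofReal_le_ofReal (le_of_eq ?_))
    (rearrangement_le_maximalRearrangement hk)
  have h1 : (2 ^ (1 / 2 - 1 / p : ℝ) : ℝ) ^ k = ((2 : ℝ) ^ k) ^ (1 / 2 - 1 / p : ℝ) := by
    rw [← Real.rpow_natCast, ← Real.rpow_mul zero_le_two, ← Real.rpow_natCast,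
      ← Real.rpow_mul zero_le_two, mul_comm]
  rw [h1, mul_comm (s ^ _), ← Real.mul_rpow (by positivity) hs.le, ← Real.rpow_add hk]
  congr 1
  ring

/-- A function in a Lorentz space `L^{(p,d)}`, `1 < p < 2`, splits into an integrable and a
square integrable part, with control of the norms. -/
theorem exists_decomposition (hp1 : 1 < p) (hp2 : p < 2) {d : ℝ≥0∞} (hd : 1 ≤ d)
    (hf : MemLorentz p d f) (hs : 0 < s) : ∃ f₀ f₁ : Space n → ℂ,
      f =ᵐ[volume] f₀ + f₁ ∧ Integrable f₀ volume ∧ MemLp f₁ 2 volume ∧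
      ∫⁻ x, ‖f₀ x‖ₑ ≤ ENNReal.ofReal (s ^ (1 - 1 / p)) * dyadicSum p f s ∧
      eLpNorm f₁ 2 volume ≤ 2 * (ENNReal.ofReal (s ^ (1 / 2 - 1 / p)) * dyadicSum p f s) := by
  -- Rearrangements ignore null sets, so a strongly measurable representative may be used; the cut
  -- set $A$ is then measurable.
  wlog hm : StronglyMeasurable f generalizing f
  · have hae := hf.1.ae_eq_mk
    obtain ⟨f₀, f₁, h, h'⟩ := this (f := hf.1.mk f)
      ⟨hf.1.stronglyMeasurable_mk.aestronglyMeasurable, lorentzNorm_congr_ae hae p d ▸ hf.2⟩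
      hf.1.stronglyMeasurable_mk
    refine ⟨f₀, f₁, hae.trans h, ?_⟩
    simpa only [dyadicSum, maximalRearrangement_congr_ae hae] using h'
  have hfin := dyadicSum_lt_top hp1 hp2 hd hf.2 hs
  set A : Set (Space n) := {x | rearrangement f s < ‖f x‖ₑ} with hA
  have hAm : MeasurableSet A := measurableSet_lt measurable_const hm.enorm
  have h0m : AEStronglyMeasurable (A.indicator f) volume := (hm.indicator hAm).aestronglyMeasurable
  have h1m : AEStronglyMeasurable (Aᶜ.indicator f) volume :=
    (hm.indicator hAm.compl).aestronglyMeasurable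
  have h0 : ∫⁻ x, ‖A.indicator f x‖ₑ ≤ ENNReal.ofReal (s ^ (1 - 1 / p)) * dyadicSum p f s := by
    refine (lintegral_enorm_indicator_le hA h0m).trans ?_
    rw [← mul_maximalRearrangement hs]
    exact mul_maximalRearrangement_le_dyadicSum hs
  have h1 : eLpNorm (Aᶜ.indicator f) 2 volume ≤
      2 * (ENNReal.ofReal (s ^ (1 / 2 - 1 / p)) * dyadicSum p f s) :=
    (eLpNorm_two_indicator_le hs hA h1m).trans
      (by gcongr; exact tsum_rpow_half_mul_rearrangement_le_dyadicSum hs)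
  refine ⟨A.indicator f, Aᶜ.indicator f, ?_, ⟨h0m, ?_⟩, ⟨h1m, ?_⟩, h0, h1⟩
  · rw [Set.indicator_self_add_compl]
  · exact h0.trans_lt (ENNReal.mul_lt_top ENNReal.ofReal_lt_top hfin)
  · exact h1.trans_lt (ENNReal.mul_lt_top ENNReal.ofNat_lt_top
      (ENNReal.mul_lt_top ENNReal.ofReal_lt_top hfin))

theorem exists_isSchrodingerFlow_decomposition (hp1 : 1 < p) (hp2 : p < 2) {d : ℝ≥0∞}
    (hd : 1 ≤ d) (hf : MemLorentz p d f) {t : ℝ} (ht : t ≠ 0) (hs : 0 < s) :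
    ∃ g₀ g₁ : Space n → ℂ, IsSchrodingerFlow t f (g₀ + g₁) ∧ MemLp g₁ 2 volume ∧
      (∀ x, ‖g₀ x‖ₑ ≤ ENNReal.ofReal (dispersiveConst n t) *
        (ENNReal.ofReal (s ^ (1 - 1 / p)) * dyadicSum p f s)) ∧
      eLpNorm g₁ 2 volume ≤ 2 * (ENNReal.ofReal (s ^ (1 / 2 - 1 / p)) * dyadicSum p f s) := by
  obtain ⟨f₀, f₁, hff, hf₀, hf₁, hb₀, hb₁⟩ := exists_decomposition hp1 hp2 hd hf hs
  have hT₀ := (memLp_one_iff_integrable.2 hf₀).isGivenBy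
  have hT₁ := hf₁.isGivenBy
  obtain ⟨g₀, hg₀, hS₀⟩ := exists_isGivenBy_schrodingerGroup_of_integrable ht hf₀ hT₀
  obtain ⟨g₁, hg₁, hgb, hS₁⟩ := exists_isGivenBy_schrodingerGroup_of_memLp_two t hf₁ hT₁
  refine ⟨g₀, g₁, ⟨_, (hT₀.add hT₁).congr_ae hff.symm, ?_⟩, hg₁, fun x => ?_, hgb.trans hb₁⟩
  · rw [map_add]
    exact hS₀.add hS₁
  · exact (hg₀ x).trans (by gcongr)

theorem IsSchrodingerFlow.ae_eq {t : ℝ} {g h : Space n → ℂ} (hg : IsSchrodingerFlow t f g)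
    (hh : IsSchrodingerFlow t f h) : g =ᵐ[volume] h := by
  obtain ⟨T, hT, hTg⟩ := hg
  obtain ⟨T', hT', hTh⟩ := hh
  obtain rfl := hT.eq hT'
  exact hTg.ae_eq hTh

theorem dispersiveConst_pos {t : ℝ} (ht : t ≠ 0) : 0 < dispersiveConst n t := by
  have := abs_pos.2 ht
  have := Real.pi_pos
  unfold dispersiveConst
  positivity

theorem rpow_mul_maximalRearrangement_le_dyadicSum (hp1 : 1 < p) (hp2 : p < 2)
    (hpp' : 1 / p + 1 / p' = 1) {d : ℝ≥0∞} (hd : 1 ≤ d) (hf : MemLorentz p d f) {t : ℝ}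
    (ht : t ≠ 0) (hψ : IsSchrodingerFlow t f ψ) {u : ℝ} (hu : 0 < u) :
    ENNReal.ofReal (u ^ (1 / p')) * maximalRearrangement ψ u ≤
      ENNReal.ofReal (5 * dispersiveConst n t ^ (2 / p - 1)) *
        dyadicSum p f (dispersiveConst n t ^ (-2 : ℝ) / u) := by
  set K := dispersiveConst n t with hK
  have hK0 : 0 < K := dispersiveConst_pos ht
  -- This level balances the two contributions: with $us=K^{-2}$ each becomes a numerical multiple
  -- of $K^{2/p-1}$, namely 1 for the $L^1$ part and 4 for the $L^2$ part, whence the 5.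
  set s := K ^ (-2 : ℝ) / u with hs
  have hs0 : 0 < s := by positivity
  obtain ⟨g₀, g₁, hg, hg₁, hb₀, hb₁⟩ :=
    exists_isSchrodingerFlow_decomposition hp1 hp2 hd hf ht hs0
  -- Uniqueness of the flow lets the fixed $\psi$ be replaced by a splitting adapted to $u$.
  have hmax := maximalRearrangement_le_add (hψ.ae_eq hg) (Filter.Eventually.of_forall hb₀) hg₁.1 hu
  set D := dyadicSum p f s
  have hscale : ∀ a : ℝ, u ^ a * s ^ a = K ^ (-2 * a) := fun a => by
    rw [← Real.mul_rpow hu.le hs0.le, hs, mul_div_cancel₀ _ hu.ne', ← Real.rpow_mul hK0.le]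
  have h1 : u ^ (1 / p') * (K * s ^ (1 - 1 / p)) = K ^ (2 / p - 1) := by
    rw [mul_left_comm, show 1 - 1 / p = 1 / p' by linarith, hscale]
    nth_rw 1 [← Real.rpow_one K]
    rw [← Real.rpow_add hK0]
    congr 1
    linear_combination (-2) * hpp'
  have h2 : u ^ (1 / p') * (2 * u ^ (-(1 / 2) : ℝ) * (2 * s ^ (1 / 2 - 1 / p))) =
      4 * K ^ (2 / p - 1) := by
    rw [show u ^ (1 / p') * (2 * u ^ (-(1 / 2) : ℝ) * (2 * s ^ (1 / 2 - 1 / p))) =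
      4 * ((u ^ (1 / p') * u ^ (-(1 / 2) : ℝ)) * s ^ (1 / 2 - 1 / p)) by ring,
      ← Real.rpow_add hu, show 1 / p' + -(1 / 2) = 1 / 2 - 1 / p by linarith, hscale]
    congr 2
    ring
  calc ENNReal.ofReal (u ^ (1 / p')) * maximalRearrangement ψ u
      ≤ ENNReal.ofReal (u ^ (1 / p')) * (ENNReal.ofReal K * (ENNReal.ofReal (s ^ (1 - 1 / p)) * D) +
          2 * ENNReal.ofReal (u ^ (-(1 / 2) : ℝ)) *
            (2 * (ENNReal.ofReal (s ^ (1 / 2 - 1 / p)) * D))) := by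
        gcongr
        exact hmax.trans (by gcongr)
    _ = ENNReal.ofReal (u ^ (1 / p') * (K * s ^ (1 - 1 / p))) * D +
          ENNReal.ofReal (u ^ (1 / p') * (2 * u ^ (-(1 / 2) : ℝ) * (2 * s ^ (1 / 2 - 1 / p)))) *
            D := by
        repeat rw [ENNReal.ofReal_mul (by positivity)]
        rw [ENNReal.ofReal_ofNat]
        ring
    _ = _ := by
        rw [h1, h2, ← add_mul, ← ENNReal.ofReal_add (by positivity) (by positivity)]
        congr 2
        ring

end Decomposition

end LorentzSchrodinger

/-! ### The Lorentz space estimate -/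

theorem lemma2p1 (n : ℕ) (p p' : ℝ) (hp1 : 1 < p) (hp2 : p < 2) (hpp' : 1 / p + 1 / p' = 1) :
    ∃ C : ℝ, 0 < C ∧ ∀ d : ℝ≥0∞, 1 ≤ d →
      ∀ φ : LorentzSchrodinger.Space n → ℂ, LorentzSchrodinger.MemLorentz p d φ →
        ∀ t : ℝ, t ≠ 0 →
          (∃ ψ : LorentzSchrodinger.Space n → ℂ, LorentzSchrodinger.IsSchrodingerFlow t φ ψ) ∧
          ∀ ψ : LorentzSchrodinger.Space n → ℂ, LorentzSchrodinger.IsSchrodingerFlow t φ ψ →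
            LorentzSchrodinger.MemLorentz p' d ψ ∧
            LorentzSchrodinger.lorentzNorm p' d ψ ≤
              ENNReal.ofReal (C * |t| ^ (-((n : ℝ) / 2) * (2 / p - 1))) *
                LorentzSchrodinger.lorentzNorm p d φ := by
  open LorentzSchrodinger in
  have hp0 : 0 < p := by linarith
  have hr1 := two_rpow_lt_one hp0 hp2
  set r : ℝ := (2 : ℝ) ^ (1 / 2 - 1 / p : ℝ) with hr
  have hinv : 1 / 2 < 1 / p := one_div_lt_one_div_of_lt hp0 hp2
  have hinv1 : 1 / p < 1 := (div_lt_one hp0).2 hp1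
  have hp'0 : 0 < p' := one_div_pos.1 (by linarith)
  have hle : p ≤ p' := (one_div_le_one_div hp'0 hp0).1 (by linarith)
  have hr1' : 0 < (1 - r)⁻¹ := inv_pos.2 (by linarith)
  have hpi := Real.pi_pos
  -- The factors are the pointwise constant, the part of $K^{2/p-1}$ independent of $t$, the sum of
  -- the geometric weights, and the normalisation ratio.
  set C : ℝ := 5 * (4 * Real.pi) ^ (-((n : ℝ) / 2) * (2 / p - 1)) * (1 - r)⁻¹ * (p' / p) with hC
  refine ⟨C, by positivity, fun d hd φ hφ t ht => ⟨?_, fun ψ hψ => ?_⟩⟩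
  -- Existence needs a single splitting, and any positive level serves.
  · obtain ⟨g₀, g₁, hg, -⟩ :=
      exists_isSchrodingerFlow_decomposition hp1 hp2 hd hφ ht one_pos
    exact ⟨_, hg⟩
  have hbound : lorentzNorm p' d ψ ≤
      ENNReal.ofReal (C * |t| ^ (-((n : ℝ) / 2) * (2 / p - 1))) * lorentzNorm p d φ := by
    have hK0 : 0 < dispersiveConst n t := dispersiveConst_pos ht
    have key := lorentzNorm_le_of_rpow_mul_maximalRearrangement_le (f := φ) (g := ψ) hp0 hle hd
      (w := fun k => ENNReal.ofReal (r ^ k))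
      (c := fun k => 2 ^ k * dispersiveConst n t ^ (-2 : ℝ)) (fun k => by positivity)
      (B := ENNReal.ofReal (5 * dispersiveConst n t ^ (2 / p - 1)))
      (by rw [tsum_dyadic_weight hp0 hp2]; exact (ENNReal.ofReal_pos.2 hr1').ne')
      (by rw [tsum_dyadic_weight hp0 hp2]; exact ENNReal.ofReal_ne_top)
      (fun u hu => by
        simpa only [dyadicSum, mul_div_assoc] using
          rpow_mul_maximalRearrangement_le_dyadicSum hp1 hp2 hpp' hd hφ ht hψ hu)
    refine key.trans_eq ?_
    rw [tsum_dyadic_weight hp0 hp2, ← ENNReal.ofReal_mul (by positivity),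
      ← ENNReal.ofReal_mul (by positivity)]
    congr 2
    rw [dispersiveConst, ← Real.rpow_mul (by positivity),
      Real.mul_rpow (by positivity) (abs_nonneg t), hC]
    ring
  -- Measurability of $\psi$ comes from the local integrability required of a representing function.
  obtain ⟨T, -, hT⟩ := id hψ
  exact ⟨⟨hT.1.aestronglyMeasurable,
    hbound.trans_lt (ENNReal.mul_lt_top ENNReal.ofReal_lt_top hφ.2)⟩, hbound⟩
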